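/- All graphs are finite, simple and undirected. For a connected graph $G$ let $D(G)$ be its distance matrix, whose $(u,v)$ entry is the length of a shortest path from $u$ to $v$, and let $\lambda_1(D(G))$ be the largest eigenvalue of $D(G)$. Let $c(G-S)$ be the number of connected components of the graph obtained from $G$ by deleting the vertex set $S$. The toughness of $G$ is $\tau(G)=\min\{|S|/c(G-S)\}$, the minimum being over all vertex cut sets $S$ (those with $c(G-S)\ge 2$), with $\tau(G)=\infty$ if $G$ is complete; $G$ is called $1$-tough if $\tau(G)\ge 1$. Write $+$ for disjoint union, $\vee$ for join, $K_m$ for the complete graph of order $m$, and $\delta K_1$ for the graph with $\delta$ vertices and no edges. **Theorem.** Let $G$ be a connected graph of order $n$ with minimum degree $\delta\ge 2$, where $n\ge \max\{8\delta,\ \tfrac12\delta^2+2\delta+2\}$. If $$\lambda_1(D(G))\le \lambda_1\bigl(D(K_\delta\vee(K_{n-2\delta}+\delta K_1))\bigr),$$ then $G$ is $1$-tough unless $G\cong K_\delta\vee(K_{n-2\delta}+\delta K_1)$, in which case $G$ is not $1$-tough. -/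

import Mathlib

open scoped ENNReal

noncomputable section

namespace SimpleGraph

/-- The distance matrix `D(G)`: the `(u, v)` entry is the distance from `u` to `v` in `G`. -/
def distMatrix {V : Type*} (G : SimpleGraph V) : Matrix V V ℝ :=
  Matrix.of fun u v => (G.dist u v : ℝ)

/-- The distance spectral radius `λ₁(D(G))`: the largest eigenvalue of the (real symmetric)
distance matrix of `G`. -/
def distSpectralRadius {V : Type*} [Fintype V] (G : SimpleGraph V) : ℝ :=
  sSup {μ : ℝ | ∃ x : V → ℝ, x ≠ 0 ∧ G.distMatrix.mulVec x = μ • x}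

/-- The number `c(G - S)` of connected components of the graph obtained from `G` by deleting the
vertices in `S`. -/
def numComponentsDelete {V : Type*} (G : SimpleGraph V) (S : Set V) : ℕ :=
  Nat.card (G.induce Sᶜ).ConnectedComponent

/-- `S` is a vertex cut set of `G`: deleting `S` leaves at least two components. -/
def IsVertexCutSet {V : Type*} (G : SimpleGraph V) (S : Set V) : Prop :=
  2 ≤ G.numComponentsDelete S

/-- The toughness `τ(G)` of a finite graph: the minimum of `|S| / c(G - S)` over all vertex cut
sets `S`. (A complete graph has no vertex cut set, and gets the customary value `∞`.) -/
def toughness {V : Type*} (G : SimpleGraph V) : ℝ≥0∞ :=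
  ⨅ (S : Set V) (_ : G.IsVertexCutSet S), (S.ncard : ℝ≥0∞) / (G.numComponentsDelete S : ℝ≥0∞)

/-- A graph is `t`-tough if its toughness is at least `t`. -/
def IsTough {V : Type*} (G : SimpleGraph V) (t : ℝ≥0∞) : Prop :=
  t ≤ G.toughness

/-- The join `G ∨ H`: the disjoint union of `G` and `H` together with all edges between
them. -/
def joinGraph {V W : Type*} (G : SimpleGraph V) (H : SimpleGraph W) : SimpleGraph (V ⊕ W) :=
  (G ⊕g H) ⊔ completeBipartiteGraph V W

/-- The graph `K_δ ∨ (K_{n-2δ} + δ K_1)`, of order `n` when `2 * δ ≤ n`. -/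
def extremalGraph (n δ : ℕ) : SimpleGraph (Fin δ ⊕ (Fin (n - 2 * δ) ⊕ Fin δ)) :=
  joinGraph (completeGraph (Fin δ))
    (completeGraph (Fin (n - 2 * δ)) ⊕g (⊥ : SimpleGraph (Fin δ)))

end SimpleGraph

end

/-!
If `G` is connected but not `1`-tough, deleting some nonempty set of `s` vertices leaves at least
`s + 1` components, so `G` is a spanning subgraph of a clique join `K_s ∨ (K_{p₀} + ⋯ + K_{pₛ})`
with `p_i ≥ max (δ - s + 1) 1`. Write the distance spectral radius of the extremal graph as
`L - 1`. On a clique join there is an explicit positive vector `x` with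
`D x = (L - 1) x + (1 or 2) (∑ x - L)` entrywise, so `∑ x ≥ L` forces `λ₁(D) ≥ L - 1`, and since
distances only grow when edges are removed, equality forces `G` to be the clique join itself. As
`∑ x` is an increasing function of `-∑ 1 / (L + p_i)`, convexity reduces `∑ x ≥ L` to the case
where all parts but one have the least size the degree condition allows. What remains is a sign
check on an explicit cubic in `L`: it is zero for the extremal graph and positive otherwise.
-/

namespace DistanceSpectrum

open SimpleGraph Matrix

section Matrix

variable {V : Type*} [Fintype V] {M : Matrix V V ℝ}

theorem mem_spectrum_iff_exists_mulVec_eq [DecidableEq V] {μ : ℝ} :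
    μ ∈ spectrum ℝ M ↔ ∃ x : V → ℝ, x ≠ 0 ∧ M *ᵥ x = μ • x := by
  rw [← spectrum_toLin', ← Module.End.hasEigenvalue_iff_mem_spectrum]
  constructor
  · intro h
    obtain ⟨x, hx⟩ := h.exists_hasEigenvector
    exact ⟨x, hx.2, by simpa using hx.apply_eq_smul⟩
  · rintro ⟨x, hx0, hx⟩
    exact Module.End.hasEigenvalue_of_hasEigenvector
      (Module.End.hasEigenvector_iff.2 ⟨Module.End.mem_eigenspace_iff.2 (by simpa using hx), hx0⟩)

open scoped MatrixOrder in
theorem dotProduct_mulVec_le_of_spectrum_le [DecidableEq V] (hM : M.IsHermitian) {l : ℝ}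
    (hl : ∀ μ ∈ spectrum ℝ M, μ ≤ l) (x : V → ℝ) : x ⬝ᵥ M *ᵥ x ≤ l * (x ⬝ᵥ x) := by
  have hle : M ≤ algebraMap ℝ (Matrix V V ℝ) l :=
    (le_algebraMap_iff_spectrum_le hM.isSelfAdjoint).2 hl
  have := (Matrix.le_iff.1 hle).dotProduct_mulVec_nonneg x
  simpa [sub_mulVec, Algebra.algebraMap_eq_smul_one, smul_mulVec] using this

/-- Pair the eigenvector equation of `y` with `x`: `μ ⟨x, |y|⟩ ≤ ⟨M x, |y|⟩ ≤ l ⟨x, |y|⟩`. -/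
theorem eigenvalue_le_of_mulVec_le (hM : M.IsSymm) (hM0 : ∀ u v, 0 ≤ M u v) {x : V → ℝ}
    (hx : ∀ v, 0 < x v) {l : ℝ} (hl : M *ᵥ x ≤ l • x) {μ : ℝ} {y : V → ℝ} (hy : y ≠ 0)
    (hμ : M *ᵥ y = μ • y) : μ ≤ l := by
  have habs : μ • |y| ≤ M *ᵥ |y| := fun u ↦ by
    calc μ * |y u| ≤ |μ| * |y u| := by gcongr; exact le_abs_self μ
      _ = |(M *ᵥ y) u| := by rw [hμ, Pi.smul_apply, smul_eq_mul, abs_mul]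
      _ ≤ ∑ v, |M u v * y v| := Finset.abs_sum_le_sum_abs _ _
      _ = (M *ᵥ |y|) u := by simp [mulVec, dotProduct, abs_mul, abs_of_nonneg (hM0 u _)]
  have hpos : 0 < x ⬝ᵥ |y| := by
    obtain ⟨v, hv⟩ := Function.ne_iff.1 hy
    exact Finset.sum_pos' (fun v _ ↦ mul_nonneg (hx v).le (abs_nonneg _))
      ⟨v, Finset.mem_univ _, mul_pos (hx v) (abs_pos.2 hv)⟩
  refine le_of_mul_le_mul_right ?_ hpos
  calc μ * (x ⬝ᵥ |y|) = x ⬝ᵥ (μ • |y|) := by rw [dotProduct_smul, smul_eq_mul]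
    _ ≤ x ⬝ᵥ M *ᵥ |y| := dotProduct_le_dotProduct_of_nonneg_left habs fun v ↦ (hx v).le
    _ = (M *ᵥ x) ⬝ᵥ |y| := by rw [dotProduct_mulVec, ← mulVec_transpose, hM.eq]
    _ ≤ (l • x) ⬝ᵥ |y| := dotProduct_le_dotProduct_of_nonneg_right hl (abs_nonneg y)
    _ = l * (x ⬝ᵥ |y|) := by rw [smul_dotProduct, smul_eq_mul]

theorem mulVec_eq_of_le_mulVec [DecidableEq V] (hM : M.IsHermitian) {l : ℝ}
    (hl : ∀ μ ∈ spectrum ℝ M, μ ≤ l) {x : V → ℝ} (hx : ∀ v, 0 < x v) (hlx : l • x ≤ M *ᵥ x) :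
    M *ᵥ x = l • x := by
  have hgap : ∀ v ∈ Finset.univ, 0 ≤ x v * (M *ᵥ x - l • x) v := fun v _ ↦
    mul_nonneg (hx v).le (sub_nonneg.2 (hlx v))
  have hsum : ∑ v, x v * (M *ᵥ x - l • x) v = 0 := by
    refine le_antisymm ?_ (Finset.sum_nonneg hgap)
    change x ⬝ᵥ (M *ᵥ x - l • x) ≤ 0
    rw [dotProduct_sub, dotProduct_smul, smul_eq_mul, sub_nonpos]
    exact dotProduct_mulVec_le_of_spectrum_le hM hl x
  ext v
  have := (Finset.sum_eq_zero_iff_of_nonneg hgap).1 hsum v (Finset.mem_univ v)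
  exact sub_eq_zero.1 ((mul_eq_zero.1 this).resolve_left (hx v).ne')

end Matrix

section DistMatrix

variable {V : Type*} {G H : SimpleGraph V}

theorem distMatrix_isSymm (G : SimpleGraph V) : G.distMatrix.IsSymm := by
  ext u v
  simp [distMatrix, dist_comm]

theorem distMatrix_nonneg (G : SimpleGraph V) (u v : V) : 0 ≤ G.distMatrix u v :=
  Nat.cast_nonneg _

theorem distMatrix_injective : Function.Injective (distMatrix (V := V)) := fun G H h ↦ by
  ext u v
  have huv : (G.dist u v : ℝ) = H.dist u v := congrFun₂ h u v
  rw [← dist_eq_one_iff_adj, ← dist_eq_one_iff_adj, Nat.cast_injective huv]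

theorem distMatrix_anti (hG : G.Connected) (h : G ≤ H) (u v : V) :
    H.distMatrix u v ≤ G.distMatrix u v :=
  Nat.cast_le.2 ((hG u v).dist_anti h)

variable [Fintype V]

theorem le_distSpectralRadius_of_mem_spectrum [DecidableEq V] {μ : ℝ}
    (hμ : μ ∈ spectrum ℝ G.distMatrix) : μ ≤ G.distSpectralRadius := by
  have hset : {μ : ℝ | ∃ x : V → ℝ, x ≠ 0 ∧ G.distMatrix *ᵥ x = μ • x} =
      spectrum ℝ G.distMatrix := Set.ext fun _ ↦ mem_spectrum_iff_exists_mulVec_eq.symm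
  rw [distSpectralRadius, hset]
  exact le_csSup G.distMatrix.finite_real_spectrum.bddAbove hμ

theorem distSpectralRadius_le {x : V → ℝ} (hx : ∀ v, 0 < x v) {l : ℝ} (hl0 : 0 ≤ l)
    (hl : G.distMatrix *ᵥ x ≤ l • x) : G.distSpectralRadius ≤ l :=
  Real.sSup_le (fun _ ⟨_, hy, hμ⟩ ↦
    eigenvalue_le_of_mulVec_le (distMatrix_isSymm G) (distMatrix_nonneg G) hx hl hy hμ) hl0

theorem eq_of_distSpectralRadius_le (hG : G.Connected) (h : G ≤ H) {x : V → ℝ}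
    (hx : ∀ v, 0 < x v) {l : ℝ} (hlx : l • x ≤ H.distMatrix *ᵥ x)
    (hl : G.distSpectralRadius ≤ l) : G = H ∧ H.distMatrix *ᵥ x = l • x := by
  classical
  have hentry : ∀ u, ∀ v ∈ Finset.univ, H.distMatrix u v * x v ≤ G.distMatrix u v * x v :=
    fun u v _ ↦ mul_le_mul_of_nonneg_right (distMatrix_anti hG h u v) (hx v).le
  have hHG : H.distMatrix *ᵥ x ≤ G.distMatrix *ᵥ x := fun u ↦ Finset.sum_le_sum (hentry u)
  have hGx : G.distMatrix *ᵥ x = l • x :=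
    mulVec_eq_of_le_mulVec (isHermitian_iff_isSymm.2 (distMatrix_isSymm G))
      (fun _ hμ ↦ (le_distSpectralRadius_of_mem_spectrum hμ).trans hl) hx (hlx.trans hHG)
  have hHx : H.distMatrix *ᵥ x = l • x := le_antisymm (hHG.trans hGx.le) hlx
  refine ⟨distMatrix_injective ?_, hHx⟩
  ext u v
  have hrow := congrFun (hHx.trans hGx.symm) u
  have huv := (Finset.sum_eq_sum_iff_of_le (hentry u)).1 hrow v (Finset.mem_univ v)
  exact (mul_right_cancel₀ (hx v).ne' huv).symm

end DistMatrix

section Excess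

/-- A cubic polynomial in `L` that vanishes when `L - 1` is the distance spectral radius of
`K_s ∨ (K_{n - s - sm} + s K_m)`. Its value is the amount by which the entries of `weight` on this
graph sum to more than `L`, cleared of the denominator `(L + m) (L + n - s - sm)`. -/
def excess (n s m L : ℝ) : ℝ :=
  s * m * (2 * L - s) * (L + n - s - s * m) - (L - n + s * m) * L * (L + m)

variable {n d s m L : ℝ}

theorem excess_div (hLm : L + m ≠ 0) (hLX : L + (n - s - s * m) ≠ 0) :
    excess n s m L / ((L + m) * (L + (n - s - s * m))) =
      s + (2 * L - s) * (s + 1 - L * (s * (L + m)⁻¹ + (L + (n - s - s * m))⁻¹)) - L := by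
  rw [excess]
  field_simp
  ring

theorem exists_excess_eq_zero (hd : 1 ≤ d) (hn : 8 * d ≤ n) :
    ∃ L, n + d ≤ L ∧ excess n d 1 L = 0 := by
  have hcont : ContinuousOn (excess n d 1) (Set.Icc (n + d) (n + 3 * d)) := by
    unfold excess
    fun_prop
  have hleft : 0 ≤ excess n d 1 (n + d) := by
    have : 0 ≤ d * ((n + d) * (2 * n - 6 * d - 2) + 3 * d ^ 2) :=
      mul_nonneg (by linarith) (add_nonneg (mul_nonneg (by linarith) (by linarith)) (by positivity))
    rw [excess]
    linarith
  have hright : excess n d 1 (n + 3 * d) ≤ 0 := by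
    have : 0 ≤ d * ((n + 3 * d) * (4 + 12 * d) - 5 * d ^ 2) :=
      mul_nonneg (by linarith) (by nlinarith)
    rw [excess]
    linarith
  obtain ⟨L, hL, hroot⟩ := intermediate_value_Icc' (by linarith) hcont ⟨hright, hleft⟩
  exact ⟨L, hL.1, hroot⟩

theorem excess_pos_of_gt (hd : 1 ≤ d) (hn : 8 * d ≤ n) (hL : n + d ≤ L)
    (hroot : excess n d 1 L = 0) (hds : d < s) (hsn : 2 * s + 1 ≤ n) : 0 < excess n s 1 L := by
  have hfactor : excess n s 1 L = (s - d) *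
      (L * (L + 2 * n - 1 - 5 * (s + d)) - n * (s + d) + 2 * (s ^ 2 + s * d + d ^ 2)) := by
    rw [excess] at hroot ⊢
    linear_combination hroot
  rw [hfactor]
  refine mul_pos (sub_pos.2 hds) ?_
  have h1 : 0 ≤ (n - 1 - 2 * s) * (5 * L + n - 2 * s - 2 * d) :=
    mul_nonneg (by linarith) (by linarith)
  have h2 : 0 ≤ (L - n - d) * L := mul_nonneg (by linarith) (by linarith)
  have h3 : 0 ≤ (n - 8 * d) * L := mul_nonneg (by linarith) (by linarith)
  nlinarith

theorem excess_pos_of_lt (hn : 8 * d ≤ n) (hL : n + d ≤ L) (hroot : excess n d 1 L = 0)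
    (hs : 1 ≤ s) (hsd : s < d) (hsn : d + 1 + s * (d - s + 1) ≤ n) :
    0 < excess n s (d - s + 1) L := by
  have hL1 : 0 < L + 1 := by linarith
  set F := (2 * L - s) * (L + n - s - s * (d - s + 1)) with hF
  set P := (2 * L - d) * (L + n - 2 * d) with hP
  have hfactor : excess n s (d - s + 1) L * (L + 1) = (d - s) *
      ((s - 1) * (F - L * (L + (d - s + 1)) - d * (2 * L - s)) * (L + 1) +
        d * (L - n + 2 * d - s) * (L + 1) + d * (2 * (L + n - 2 * d) * (L + 1) - P)) := by
    rw [excess] at hroot ⊢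
    rw [hF, hP]
    linear_combination (L + (d - s + 1)) * hroot
  have hF_ge : 0 ≤ F - L * (L + (d - s + 1)) - d * (2 * L - s) := by
    have : (2 * L - s) * (L + 1 - s) ≤ (2 * L - s) * (L + n - s - s * (d - s + 1) - d) :=
      mul_le_mul_of_nonneg_left (by linarith) (by linarith)
    have : 0 ≤ L * (L - 8 * d) := mul_nonneg (by linarith) (by linarith)
    nlinarith
  have hP_le : P ≤ 2 * (L + n - 2 * d) * (L + 1) := by
    have : 0 ≤ (d + 2) * (L + n - 2 * d) := mul_nonneg (by linarith) (by linarith)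
    linarith
  refine pos_of_mul_pos_left (b := L + 1) ?_ hL1.le
  rw [hfactor]
  refine mul_pos (sub_pos.2 hsd) ?_
  have h1 : 0 ≤ (s - 1) * (F - L * (L + (d - s + 1)) - d * (2 * L - s)) * (L + 1) :=
    mul_nonneg (mul_nonneg (by linarith) hF_ge) hL1.le
  have h2 : 0 < d * (L - n + 2 * d - s) * (L + 1) :=
    mul_pos (mul_pos (by linarith) (by linarith)) hL1
  have h3 : 0 ≤ d * (2 * (L + n - 2 * d) * (L + 1) - P) :=
    mul_nonneg (by linarith) (sub_nonneg.2 hP_le)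
  linarith

theorem eq_or_excess_pos {n d s : ℕ} (hd : 1 ≤ d) (hn : 8 * d ≤ n) {L : ℝ} (hL : (n + d : ℝ) ≤ L)
    (hroot : excess n d 1 L = 0) (hs : 1 ≤ s) (hsn : s + (s + 1) * (d - s + 1) ≤ n) :
    s = d ∨ 0 < excess n s (d - s + 1 : ℕ) L := by
  have hd' : (1 : ℝ) ≤ d := by exact_mod_cast hd
  have hn' : (8 * d : ℝ) ≤ n := by exact_mod_cast hn
  have hsn' : (s + (s + 1) * (d - s + 1 : ℕ) : ℝ) ≤ n := by exact_mod_cast hsn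
  rcases lt_trichotomy s d with hlt | heq | hgt
  · rw [Nat.cast_add_one, Nat.cast_sub hlt.le] at hsn' ⊢
    exact .inr (excess_pos_of_lt hn' hL hroot (by exact_mod_cast hs) (by exact_mod_cast hlt)
      (by linarith))
  · exact .inl heq
  · rw [Nat.sub_eq_zero_of_le hgt.le, zero_add, Nat.cast_one] at hsn' ⊢
    exact .inr (excess_pos_of_gt hd' hn' hL hroot (by exact_mod_cast hgt) (by linarith))

end Excess

section Convexity

variable {a b t : ℝ}

theorem chord_sub_inv (ha : a ≠ 0) (hb : b ≠ 0) (ht : t ≠ 0) :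
    a⁻¹ + b⁻¹ - t * (a * b)⁻¹ - t⁻¹ = (t - a) * (b - t) / (a * b * t) := by
  field_simp
  ring

theorem inv_le_chord (ha : 0 < a) (hat : a ≤ t) (htb : t ≤ b) :
    t⁻¹ ≤ a⁻¹ + b⁻¹ - t * (a * b)⁻¹ := by
  have ht : 0 < t := ha.trans_le hat
  have hb : 0 < b := ht.trans_le htb
  rw [← sub_nonneg, chord_sub_inv ha.ne' hb.ne' ht.ne']
  exact div_nonneg (mul_nonneg (sub_nonneg.2 hat) (sub_nonneg.2 htb)) (by positivity)

variable {ι : Type*} [Fintype ι] {f : ι → ℝ}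

theorem sum_chord (ha : a ≠ 0) (hb : b ≠ 0) (hsum : ∑ i, (f i - a) = b - a) :
    ∑ i, (a⁻¹ + b⁻¹ - f i * (a * b)⁻¹) = (Fintype.card ι - 1) * a⁻¹ + b⁻¹ := by
  have hf : ∑ i, f i = b - a + Fintype.card ι * a := by
    rw [← hsum]
    simp [Finset.sum_sub_distrib]
  rw [Finset.sum_sub_distrib, ← Finset.sum_mul, hf, Finset.sum_const, Finset.card_univ,
    nsmul_eq_mul]
  field_simp
  ring

theorem le_of_sum_sub_eq (hf : ∀ i, a ≤ f i) (hsum : ∑ i, (f i - a) = b - a) (i : ι) : f i ≤ b := by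
  have := Finset.single_le_sum (fun j _ ↦ sub_nonneg.2 (hf j)) (Finset.mem_univ i)
  linarith

theorem sum_inv_le (ha : 0 < a) (hb : 0 < b) (hf : ∀ i, a ≤ f i)
    (hsum : ∑ i, (f i - a) = b - a) :
    ∑ i, (f i)⁻¹ ≤ (Fintype.card ι - 1) * a⁻¹ + b⁻¹ :=
  (Finset.sum_le_sum fun i _ ↦ inv_le_chord ha (hf i) (le_of_sum_sub_eq hf hsum i)).trans_eq
    (sum_chord ha.ne' hb.ne' hsum)

theorem exists_forall_ne_eq_of_sum_inv_eq [Nonempty ι] (ha : 0 < a) (hb : 0 < b)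
    (hf : ∀ i, a ≤ f i) (hsum : ∑ i, (f i - a) = b - a)
    (heq : ∑ i, (f i)⁻¹ = (Fintype.card ι - 1) * a⁻¹ + b⁻¹) : ∃ i, ∀ j ≠ i, f j = a := by
  classical
  have hends : ∀ i, f i ≠ a → f i = b := fun i hi ↦ by
    have hfi : 0 < f i := ha.trans_le (hf i)
    have := (Finset.sum_eq_sum_iff_of_le fun i _ ↦
      inv_le_chord ha (hf i) (le_of_sum_sub_eq hf hsum i)).1
        (heq.trans (sum_chord ha.ne' hb.ne' hsum).symm) i (Finset.mem_univ i)
    have hgap := chord_sub_inv ha.ne' hb.ne' hfi.ne'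
    rw [← this, sub_self, eq_comm, div_eq_zero_iff, or_iff_left (by positivity), mul_eq_zero,
      sub_eq_zero, sub_eq_zero] at hgap
    exact (hgap.resolve_left hi).symm
  by_cases hall : ∀ i, f i = a
  · exact ⟨Classical.arbitrary ι, fun j _ ↦ hall j⟩
  · push Not at hall
    obtain ⟨i, hi⟩ := hall
    rw [← Finset.add_sum_erase _ _ (Finset.mem_univ i), hends i hi, add_eq_left,
      Finset.sum_eq_zero_iff_of_nonneg fun j _ ↦ sub_nonneg.2 (hf j)] at hsum
    exact ⟨i, fun j hj ↦ sub_eq_zero.1 (hsum j (Finset.mem_erase.2 ⟨hj, Finset.mem_univ j⟩))⟩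

end Convexity

section CliqueJoin

variable {V ι : Type*}

/-- The join `K_s ∨ (K_{p₁} + ⋯ + K_{pₖ})` on the vertex set `V`, encoded by a labelling `c`: the
`s` dominating vertices are those labelled `none`, and the clique `K_{pᵢ}` consists of the vertices
labelled `some i`. -/
def cliqueJoin (c : V → Option ι) : SimpleGraph V where
  Adj u v := u ≠ v ∧ (c u = none ∨ c v = none ∨ c u = c v)
  symm.symm _ _ := fun ⟨hne, h⟩ ↦ ⟨hne.symm, by tauto⟩
  loopless.irrefl _ h := h.1 rfl

/-- The number of vertices with label `o`: the parameters `s` and `pᵢ` of `cliqueJoin c`. -/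
def labelCard [Fintype V] [DecidableEq ι] (c : V → Option ι) (o : Option ι) : ℕ :=
  Finset.card {v | c v = o}

open scoped Classical in
theorem dist_cliqueJoin {c : V → Option ι} {w : V} (hw : c w = none) (u v : V) :
    (cliqueJoin c).dist u v =
      if u = v then 0 else if c u = none ∨ c v = none ∨ c u = c v then 1 else 2 := by
  split_ifs with huv hadj
  · rw [huv, dist_self]
  · exact dist_eq_one_iff_adj.2 ⟨huv, hadj⟩
  · have huw : (cliqueJoin c).Adj u w := ⟨fun h ↦ hadj (.inl (h ▸ hw)), .inr (.inl hw)⟩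
    have hwv : (cliqueJoin c).Adj w v := ⟨fun h ↦ hadj (.inr (.inl (h ▸ hw))), .inl hw⟩
    refine le_antisymm (dist_le (.cons huw (.cons hwv .nil))) ?_
    exact (huw.reachable.trans hwv.reachable).one_lt_dist_of_ne_of_not_adj huv fun h ↦ hadj h.2

theorem nonempty_iso_cliqueJoin [Fintype V] [DecidableEq ι] {W : Type*} [Fintype W]
    {c : V → Option ι} {c' : W → Option ι} (h : ∀ o, labelCard c o = labelCard c' o) :
    Nonempty (cliqueJoin c ≃g cliqueJoin c') := by
  have hfiber : ∀ o, Nonempty ({v // c v = o} ≃ {w // c' w = o}) := fun o ↦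
    Fintype.card_eq.1 (by simpa only [labelCard, Fintype.card_subtype] using h o)
  let e : V ≃ W := Equiv.ofFiberEquiv fun o ↦ (hfiber o).some
  have he : ∀ v, c' (e v) = c v := Equiv.ofFiberEquiv_map _
  exact ⟨⟨e, fun {u v} ↦ by simp only [cliqueJoin, he, e.injective.ne_iff]⟩⟩

variable [Fintype V]

theorem distMatrix_cliqueJoin_mulVec_of_eq_none {c : V → Option ι} {u : V} (hu : c u = none)
    (z : Option ι → ℝ) :
    ((cliqueJoin c).distMatrix *ᵥ (z ∘ c)) u = ∑ v, z (c v) - z none := by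
  classical
  have hentry : ∀ v, (cliqueJoin c).distMatrix u v * z (c v) =
      z (c v) - if u = v then z (c v) else 0 := fun v ↦ by
    by_cases huv : u = v <;> simp [distMatrix, dist_cliqueJoin hu, huv, hu]
  simp [mulVec, dotProduct, hentry, Finset.sum_sub_distrib, hu]

variable [DecidableEq ι]

theorem labelCard_eq_ncard (c : V → Option ι) (o : Option ι) :
    labelCard c o = {v | c v = o}.ncard := by
  rw [labelCard, ← Set.ncard_coe_finset, Finset.coe_filter_univ]

theorem labelCard_pos_iff {c : V → Option ι} {o : Option ι} :
    0 < labelCard c o ↔ ∃ v, c v = o := by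
  simp [labelCard, Finset.card_pos, Finset.Nonempty]

theorem sum_ite_label (c : V → Option ι) (z : Option ι → ℝ) (o : Option ι) :
    ∑ v, (if c v = o then z (c v) else 0) = labelCard c o * z o := by
  rw [← Finset.sum_filter, Finset.sum_congr rfl fun v hv ↦ by rw [(Finset.mem_filter.1 hv).2],
    Finset.sum_const, nsmul_eq_mul, labelCard]

theorem labelCard_none_add_sum [Fintype ι] (c : V → Option ι) :
    labelCard c none + ∑ i, labelCard c (some i) = Fintype.card V := by
  rw [← Fintype.sum_option, ← Finset.card_univ]
  exact (Finset.card_eq_sum_card_fiberwise fun _ _ ↦ Finset.mem_univ _).symm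

theorem distMatrix_cliqueJoin_mulVec_of_eq_some {c : V → Option ι} (hc : ∃ w, c w = none) {u : V}
    {i : ι} (hu : c u = some i) (z : Option ι → ℝ) :
    ((cliqueJoin c).distMatrix *ᵥ (z ∘ c)) u = 2 * ∑ v, z (c v) - labelCard c none * z none
      - (labelCard c (some i) + 1) * z (some i) := by
  classical
  obtain ⟨w, hw⟩ := hc
  have hentry : ∀ v, (cliqueJoin c).distMatrix u v * z (c v) =
      2 * z (c v) - (if c v = none then z (c v) else 0)
        - (if c v = some i then z (c v) else 0) - if u = v then z (c v) else 0 := fun v ↦ by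
    rw [distMatrix, of_apply, dist_cliqueJoin hw]
    rcases eq_or_ne u v with rfl | huv
    · simp only [hu, reduceCtorEq, if_true, if_false, Nat.cast_zero]
      ring
    · rcases c v with _ | j
      · simp only [huv, reduceCtorEq, true_or, or_true, if_true, if_false, Nat.cast_one]
        ring
      · rcases eq_or_ne j i with rfl | hij
        · simp only [huv, ↓reduceIte, hu, reduceCtorEq, or_true, Nat.cast_one]
          ring
        · simp [huv, hu, hij, hij.symm]
  simp only [mulVec, dotProduct, Function.comp_apply, hentry, Finset.sum_sub_distrib,
    sum_ite_label, ← Finset.mul_sum, Finset.sum_ite_eq, Finset.mem_univ, if_true, hu]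
  ring

/-- A vector constant on label classes, scaled to be `1` on the dominating vertices, whose value on
each clique of `cliqueJoin c` is the one forced by the eigenvalue equation for `L - 1` when the
entries sum to `L`. -/
noncomputable def weight (c : V → Option ι) (L : ℝ) : Option ι → ℝ
  | none => 1
  | some i => (2 * L - labelCard c none) / (L + labelCard c (some i))

theorem weight_pos {c : V → Option ι} {L : ℝ} (hL0 : 0 < L) (hL : (labelCard c none : ℝ) < 2 * L) :
    ∀ o, 0 < weight c L o
  | none => one_pos
  | some _ => div_pos (by linarith) (by positivity)

theorem sum_weight [Fintype ι] (c : V → Option ι) {L : ℝ} (hL0 : 0 < L) :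
    ∑ v, weight c L (c v) = labelCard c none + (2 * L - labelCard c none) *
      (Fintype.card ι - L * ∑ i, (L + labelCard c (some i) : ℝ)⁻¹) := by
  have hclass : ∀ i, labelCard c (some i) * weight c L (some i) =
      (2 * L - labelCard c none) * (1 - L * (L + labelCard c (some i) : ℝ)⁻¹) := fun i ↦ by
    rw [weight]
    field_simp
    ring
  calc ∑ v, weight c L (c v) = ∑ o, labelCard c o * weight c L o := by
        simp_rw [← sum_ite_label]
        rw [Finset.sum_comm]
        simp
    _ = _ := by
        rw [Fintype.sum_option, Finset.sum_congr rfl fun i _ ↦ hclass i, ← Finset.mul_sum,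
          Finset.sum_sub_distrib, ← Finset.mul_sum]
        simp [weight]

theorem distMatrix_cliqueJoin_mulVec_weight {c : V → Option ι} (hc : ∃ w, c w = none) {L : ℝ}
    (hL0 : 0 < L) (u : V) :
    ((cliqueJoin c).distMatrix *ᵥ (weight c L ∘ c)) u = (L - 1) * weight c L (c u) +
      (if c u = none then 1 else 2) * (∑ v, weight c L (c v) - L) := by
  rcases hu : c u with _ | i
  · rw [distMatrix_cliqueJoin_mulVec_of_eq_none hu, if_pos rfl, weight]
    ring
  · have hden : L + (labelCard c (some i) : ℝ) ≠ 0 := by positivity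
    rw [distMatrix_cliqueJoin_mulVec_of_eq_some hc hu, if_neg (Option.some_ne_none i)]
    simp only [weight]
    field_simp
    ring

theorem distSpectralRadius_cliqueJoin_le {c : V → Option ι} (hc : ∃ w, c w = none) {L : ℝ}
    (hL1 : 1 ≤ L) (hL : (labelCard c none : ℝ) < 2 * L) (hsum : ∑ v, weight c L (c v) = L) :
    (cliqueJoin c).distSpectralRadius ≤ L - 1 := by
  refine distSpectralRadius_le (x := weight c L ∘ c) (fun v ↦ weight_pos (by linarith) hL (c v))
    (by linarith) fun u ↦ ?_
  rw [distMatrix_cliqueJoin_mulVec_weight hc (by linarith), hsum, sub_self, mul_zero, add_zero,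
    Pi.smul_apply, smul_eq_mul, Function.comp_apply]

theorem eq_cliqueJoin_of_distSpectralRadius_le {G : SimpleGraph V} {c : V → Option ι}
    (hconn : G.Connected) (hG : G ≤ cliqueJoin c) (hc : ∃ w, c w = none) {L : ℝ} (hL0 : 0 < L)
    (hL : (labelCard c none : ℝ) < 2 * L) (hsum : L ≤ ∑ v, weight c L (c v))
    (hspec : G.distSpectralRadius ≤ L - 1) :
    G = cliqueJoin c ∧ ∑ v, weight c L (c v) = L := by
  have hsub : (L - 1) • (weight c L ∘ c) ≤ (cliqueJoin c).distMatrix *ᵥ (weight c L ∘ c) :=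
    fun u ↦ by
      rw [distMatrix_cliqueJoin_mulVec_weight hc hL0]
      exact le_add_of_nonneg_right (mul_nonneg (by split_ifs <;> norm_num) (sub_nonneg.2 hsum))
  obtain ⟨hGc, heig⟩ := eq_of_distSpectralRadius_le (x := weight c L ∘ c) hconn hG
    (fun v ↦ weight_pos hL0 hL (c v)) hsub hspec
  refine ⟨hGc, ?_⟩
  obtain ⟨w, hw⟩ := hc
  have hrow := congrFun heig w
  rw [distMatrix_cliqueJoin_mulVec_weight ⟨w, hw⟩ hL0, if_pos hw, Pi.smul_apply, smul_eq_mul,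
    Function.comp_apply] at hrow
  linarith

theorem minDegree_lt_labelCard_add {G : SimpleGraph V} [DecidableRel G.Adj] {c : V → Option ι}
    (hG : G ≤ cliqueJoin c) {i : ι} (hi : ∃ v, c v = some i) :
    G.minDegree < labelCard c none + labelCard c (some i) := by
  classical
  obtain ⟨v, hv⟩ := hi
  have hsub : insert v (G.neighborFinset v) ⊆
      ({u | c u = none} : Finset V) ∪ ({u | c u = some i} : Finset V) := by
    intro u hu
    rcases Finset.mem_insert.1 hu with rfl | hu
    · simp [hv]
    · have := (hG ((G.mem_neighborFinset v u).1 hu)).2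
      simp only [hv, reduceCtorEq, false_or] at this
      simpa [eq_comm] using this
  calc G.minDegree < G.degree v + 1 := Nat.lt_succ_of_le (G.minDegree_le_degree v)
    _ = (insert v (G.neighborFinset v)).card := by
      rw [Finset.card_insert_of_notMem (G.notMem_neighborFinset_self v),
        card_neighborFinset_eq_degree]
    _ ≤ _ := (Finset.card_le_card hsub).trans (Finset.card_union_le _ _)

variable [Fintype ι] {c : V → Option ι} {m : ℕ} {L : ℝ}

theorem sum_add_labelCard_sub (hι : Fintype.card ι = labelCard c none + 1) :
    ∑ i, (L + labelCard c (some i) - (L + m) : ℝ) =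
      L + (Fintype.card V - labelCard c none - labelCard c none * m) - (L + m) := by
  rw [← labelCard_none_add_sum c, Finset.sum_congr rfl fun i _ ↦ add_sub_add_left_eq_sub _ _ _,
    Finset.sum_sub_distrib, Finset.sum_const, Finset.card_univ, hι, nsmul_eq_mul]
  push_cast
  ring

theorem labelCard_none_add_mul_le_card (hι : Fintype.card ι = labelCard c none + 1)
    (hm : ∀ i, m ≤ labelCard c (some i)) :
    labelCard c none + (labelCard c none + 1) * m ≤ Fintype.card V := by
  rw [← labelCard_none_add_sum c, ← hι]
  exact Nat.add_le_add_left (Finset.card_nsmul_le_sum _ _ _ fun i _ ↦ hm i) _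

theorem add_card_sub_labelCard_pos (hL0 : 0 < L) (hι : Fintype.card ι = labelCard c none + 1)
    (hm : ∀ i, m ≤ labelCard c (some i)) :
    0 < L + (Fintype.card V - labelCard c none - labelCard c none * m) := by
  have : (labelCard c none + (labelCard c none + 1) * m : ℝ) ≤ Fintype.card V := by
    exact_mod_cast labelCard_none_add_mul_le_card hι hm
  nlinarith [(Nat.cast_nonneg m : (0 : ℝ) ≤ m)]

theorem sum_weight_sub (hL0 : 0 < L) (hι : Fintype.card ι = labelCard c none + 1)
    (hm : ∀ i, m ≤ labelCard c (some i)) :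
    ∑ v, weight c L (c v) - L = excess (Fintype.card V) (labelCard c none) m L /
        ((L + m) * (L + (Fintype.card V - labelCard c none - labelCard c none * m))) +
      (2 * L - labelCard c none) * L * ((Fintype.card ι - 1) * (L + m)⁻¹ +
        (L + (Fintype.card V - labelCard c none - labelCard c none * m))⁻¹ -
        ∑ i, (L + labelCard c (some i) : ℝ)⁻¹) := by
  rw [sum_weight c hL0, excess_div (by positivity) (add_card_sub_labelCard_pos hL0 hι hm).ne', hι]
  push_cast
  ring

theorem le_sum_weight (hL0 : 0 < L) (hL : (labelCard c none : ℝ) < 2 * L)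
    (hι : Fintype.card ι = labelCard c none + 1) (hm : ∀ i, m ≤ labelCard c (some i))
    (hexcess : 0 ≤ excess (Fintype.card V) (labelCard c none) m L) :
    L ≤ ∑ v, weight c L (c v) := by
  have hX := add_card_sub_labelCard_pos hL0 hι hm
  have hinv := sum_inv_le (by positivity) hX
    (fun i ↦ add_le_add_right (Nat.cast_le.2 (hm i)) L) (sum_add_labelCard_sub hι)
  rw [← sub_nonneg, sum_weight_sub hL0 hι hm]
  exact add_nonneg (div_nonneg hexcess (by positivity))
    (mul_nonneg (mul_nonneg (by linarith) hL0.le) (sub_nonneg.2 hinv))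

theorem excess_eq_zero_and_exists_of_sum_weight_eq (hL0 : 0 < L)
    (hL : (labelCard c none : ℝ) < 2 * L) (hι : Fintype.card ι = labelCard c none + 1)
    (hm : ∀ i, m ≤ labelCard c (some i))
    (hexcess : 0 ≤ excess (Fintype.card V) (labelCard c none) m L)
    (hsum : ∑ v, weight c L (c v) = L) :
    excess (Fintype.card V) (labelCard c none) m L = 0 ∧
      ∃ i, ∀ j ≠ i, labelCard c (some j) = m := by
  have : Nonempty ι := Fintype.card_pos_iff.1 (by omega)
  have hX := add_card_sub_labelCard_pos hL0 hι hm
  have hm' : ∀ i, L + m ≤ L + labelCard c (some i) := fun i ↦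
    add_le_add_right (Nat.cast_le.2 (hm i)) L
  have hsumL := sum_add_labelCard_sub (L := L) (m := m) hι
  have hcoef : 0 < (2 * L - labelCard c none) * L := mul_pos (by linarith) hL0
  have hden := mul_pos (by positivity : 0 < L + m) hX
  have hsplit := sum_weight_sub hL0 hι hm
  rw [hsum, sub_self, eq_comm, add_eq_zero_iff_of_nonneg (div_nonneg hexcess hden.le)
    (mul_nonneg hcoef.le (sub_nonneg.2 (sum_inv_le (by positivity) hX hm' hsumL))),
    div_eq_zero_iff, or_iff_left hden.ne', mul_eq_zero, or_iff_right hcoef.ne', sub_eq_zero]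
    at hsplit
  obtain ⟨i, hi⟩ :=
    exists_forall_ne_eq_of_sum_inv_eq (by positivity) hX hm' hsumL hsplit.2.symm
  exact ⟨hsplit.1, i, fun j hj ↦ Nat.cast_injective (add_left_cancel (hi j hj))⟩

theorem eq_cliqueJoin_of_excess_nonneg {G : SimpleGraph V} (hconn : G.Connected)
    (hG : G ≤ cliqueJoin c) (hc : ∃ w, c w = none) (hL0 : 0 < L)
    (hL : (labelCard c none : ℝ) < 2 * L) (hι : Fintype.card ι = labelCard c none + 1)
    (hm : ∀ i, m ≤ labelCard c (some i))
    (hexcess : 0 ≤ excess (Fintype.card V) (labelCard c none) m L)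
    (hspec : G.distSpectralRadius ≤ L - 1) :
    G = cliqueJoin c ∧ excess (Fintype.card V) (labelCard c none) m L = 0 ∧
      ∃ i, ∀ j ≠ i, labelCard c (some j) = m := by
  obtain ⟨hGc, hsum⟩ := eq_cliqueJoin_of_distSpectralRadius_le hconn hG hc hL0 hL
    (le_sum_weight hL0 hL hι hm hexcess) hspec
  exact ⟨hGc, excess_eq_zero_and_exists_of_sum_weight_eq hL0 hL hι hm hexcess hsum⟩

end CliqueJoin

section ExtremalGraph

/-- The labelling exhibiting `K_d ∨ (K_{n-2d} + d K_1)` as a clique join, with the large clique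
labelled `i`. -/
def extremalLabel (n d : ℕ) (i : Fin (d + 1)) :
    Fin d ⊕ (Fin (n - 2 * d) ⊕ Fin d) → Option (Fin (d + 1))
  | .inl _ => none
  | .inr (.inl _) => some i
  | .inr (.inr j) => some (i.succAbove j)

variable {n d : ℕ}

theorem extremalGraph_eq_cliqueJoin (i : Fin (d + 1)) :
    extremalGraph n d = cliqueJoin (extremalLabel n d i) := by
  ext u v
  rcases u with u | u | u <;> rcases v with v | v | v <;>
    simp [extremalGraph, joinGraph, cliqueJoin, extremalLabel, Fin.ne_succAbove, Fin.succAbove_ne]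

theorem labelCard_extremalLabel_none (i : Fin (d + 1)) :
    labelCard (extremalLabel n d i) none = d := by
  rw [labelCard, Finset.card_filter]
  simp [Fintype.sum_sum_type, extremalLabel]

theorem labelCard_extremalLabel_self (i : Fin (d + 1)) :
    labelCard (extremalLabel n d i) (some i) = n - 2 * d := by
  rw [labelCard, Finset.card_filter]
  simp [Fintype.sum_sum_type, extremalLabel, Fin.succAbove_ne]

theorem labelCard_extremalLabel_of_ne {i j : Fin (d + 1)} (hji : j ≠ i) :
    labelCard (extremalLabel n d i) (some j) = 1 := by
  obtain ⟨k, rfl⟩ := Fin.exists_succAbove_eq hji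
  rw [labelCard, Finset.card_filter]
  simp [Fintype.sum_sum_type, extremalLabel, Fin.ne_succAbove]

theorem distSpectralRadius_extremalGraph_le (hd : 1 ≤ d) (hn : 2 * d ≤ n) {L : ℝ}
    (hL : (n : ℝ) ≤ L) (hroot : excess n d 1 L = 0) :
    (extremalGraph n d).distSpectralRadius ≤ L - 1 := by
  have hd' : (1 : ℝ) ≤ d := by exact_mod_cast hd
  have hn' : (2 * d : ℝ) ≤ n := by exact_mod_cast hn
  have hroot' := excess_div (n := n) (s := d) (m := 1) (L := L) (by linarith) (by linarith)
  rw [hroot, zero_div, mul_one, sub_sub, ← two_mul] at hroot'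
  rw [extremalGraph_eq_cliqueJoin 0]
  refine distSpectralRadius_cliqueJoin_le ⟨.inl ⟨0, hd⟩, rfl⟩ (by linarith) ?_ ?_
  · rw [labelCard_extremalLabel_none]
    linarith
  · rw [sum_weight _ (by linarith), Fin.sum_univ_succAbove _ 0]
    simp only [labelCard_extremalLabel_none, labelCard_extremalLabel_self,
      labelCard_extremalLabel_of_ne (Fin.succAbove_ne 0 _), Finset.sum_const, Finset.card_univ,
      Fintype.card_fin, nsmul_eq_mul, Nat.cast_one, Nat.cast_add, Nat.cast_sub hn, Nat.cast_mul,
      Nat.cast_ofNat]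
    linear_combination -hroot'

theorem nonempty_iso_extremalGraph {V : Type*} [Fintype V] (hcard : Fintype.card V = n)
    {c : V → Option (Fin (d + 1))} (hnone : labelCard c none = d) {i : Fin (d + 1)}
    (hi : ∀ j ≠ i, labelCard c (some j) = 1) : Nonempty (cliqueJoin c ≃g extremalGraph n d) := by
  have htotal := labelCard_none_add_sum c
  rw [hcard, hnone, Fin.sum_univ_succAbove _ i,
    Finset.sum_congr rfl fun j _ ↦ hi _ (Fin.succAbove_ne i j)] at htotal
  simp only [Finset.sum_const, Finset.card_univ, Fintype.card_fin, smul_eq_mul, mul_one]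
    at htotal
  rw [extremalGraph_eq_cliqueJoin i]
  refine nonempty_iso_cliqueJoin fun
    | none => by rw [hnone, labelCard_extremalLabel_none]
    | some j => ?_
  rcases eq_or_ne j i with rfl | hji
  · rw [labelCard_extremalLabel_self]
    omega
  · rw [hi j hji, labelCard_extremalLabel_of_ne hji]

theorem nonempty_iso_extremalGraph_of_le_cliqueJoin {V : Type*} [Fintype V] {G : SimpleGraph V}
    [DecidableRel G.Adj] (hconn : G.Connected) (hcard : Fintype.card V = n)
    (hmin : d ≤ G.minDegree) (hd : 1 ≤ d) (hn : 8 * d ≤ n)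
    (hspec : G.distSpectralRadius ≤ (extremalGraph n d).distSpectralRadius) {s : ℕ}
    {c : V → Option (Fin (s + 1))} (hs : 1 ≤ s) (hnone : labelCard c none = s)
    (hsome : ∀ i, ∃ v, c v = some i) (hG : G ≤ cliqueJoin c) :
    Nonempty (G ≃g extremalGraph n d) := by
  have hι : Fintype.card (Fin (s + 1)) = labelCard c none + 1 := by rw [hnone, Fintype.card_fin]
  have hm : ∀ i, d - s + 1 ≤ labelCard c (some i) := fun i ↦ by
    have := minDegree_lt_labelCard_add hG (hsome i)
    have := labelCard_pos_iff.2 (hsome i)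
    omega
  have hsn := labelCard_none_add_mul_le_card hι hm
  rw [hnone, hcard] at hsn
  obtain ⟨L, hL, hroot⟩ := exists_excess_eq_zero (n := n) (d := d) (by exact_mod_cast hd)
    (by exact_mod_cast hn)
  have hLn : (n : ℝ) ≤ L := by linarith [(Nat.cast_nonneg d : (0 : ℝ) ≤ d)]
  have hL0 : 0 < L := (Nat.cast_pos.2 (by omega)).trans_le hLn
  have hLs : (labelCard c none : ℝ) < 2 * L := by
    have : (labelCard c none : ℝ) ≤ n := by exact_mod_cast (by omega : labelCard c none ≤ n)
    linarith
  have hsd := eq_or_excess_pos hd hn hL hroot hs hsn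
  have hexcess : 0 ≤ excess (Fintype.card V) (labelCard c none) (d - s + 1 : ℕ) L := by
    rw [hcard, hnone]
    rcases hsd with rfl | hpos
    · simpa using hroot.ge
    · exact hpos.le
  obtain ⟨hGc, hzero, i, hi⟩ := eq_cliqueJoin_of_excess_nonneg hconn hG
    (labelCard_pos_iff.1 (hnone.symm ▸ hs)) hL0 hLs hι hm hexcess
    (hspec.trans (distSpectralRadius_extremalGraph_le hd (by omega) hLn hroot))
  rw [hcard, hnone] at hzero
  obtain rfl := hsd.resolve_right hzero.not_gt
  rw [hGc]
  exact nonempty_iso_extremalGraph hcard hnone fun j hj ↦ by simpa using hi j hj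

end ExtremalGraph

section Toughness

variable {V : Type*} {G : SimpleGraph V}

theorem one_le_ncard_div_numComponentsDelete_iff {S : Set V} (hS : G.IsVertexCutSet S) :
    1 ≤ (S.ncard : ℝ≥0∞) / G.numComponentsDelete S ↔ G.numComponentsDelete S ≤ S.ncard := by
  have hpos : (G.numComponentsDelete S : ℝ≥0∞) ≠ 0 :=
    Nat.cast_ne_zero.2 (Nat.ne_of_gt (two_pos.trans_le hS))
  rw [ENNReal.le_div_iff_mul_le (.inl hpos) (.inl (ENNReal.natCast_ne_top _)), one_mul,
    Nat.cast_le]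

variable [Finite V]

theorem isTough_one_iff (hG : G.Connected) :
    G.IsTough 1 ↔ ∀ S : Set V, S.Nonempty → G.numComponentsDelete S ≤ S.ncard := by
  simp only [IsTough, toughness, le_iInf_iff]
  constructor
  · intro h S hS
    by_cases hcut : G.IsVertexCutSet S
    · exact (one_le_ncard_div_numComponentsDelete_iff hcut).1 (h S hcut)
    · exact (Nat.lt_succ_iff.1 (not_le.1 hcut)).trans ((Set.ncard_pos S.toFinite).2 hS)
  · intro h S hcut
    refine (one_le_ncard_div_numComponentsDelete_iff hcut).2 (h S (Set.nonempty_iff_ne_empty.2 ?_))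
    rintro rfl
    have hconn : (G.induce (∅ : Set V)ᶜ).Connected := by
      rw [Set.compl_empty]
      exact (induceUnivIso G).connected_iff.2 hG
    have := hconn.preconnected.subsingleton_connectedComponent
    exact absurd hcut (not_le.2 (Nat.lt_succ_of_le (Finite.card_le_one_iff_subsingleton.2 this)))

theorem exists_le_cliqueJoin_of_le_numComponentsDelete {S : Set V} {k : ℕ}
    (hk : k + 1 ≤ G.numComponentsDelete S) :
    ∃ c : V → Option (Fin (k + 1)), (∀ v, c v = none ↔ v ∈ S) ∧ (∀ i, ∃ v, c v = some i) ∧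
      G ≤ cliqueJoin c := by
  classical
  have := Fintype.ofFinite (G.induce Sᶜ).ConnectedComponent
  rw [numComponentsDelete, Nat.card_eq_fintype_card] at hk
  obtain ⟨g⟩ : Nonempty (Fin (k + 1) ↪ (G.induce Sᶜ).ConnectedComponent) :=
    Function.Embedding.nonempty_of_card_le (by rwa [Fintype.card_fin])
  let part (v : (Sᶜ : Set V)) : Fin (k + 1) :=
    Function.invFun g ((G.induce Sᶜ).connectedComponentMk v)
  refine ⟨fun v ↦ if hv : v ∈ Sᶜ then some (part ⟨v, hv⟩) else none, fun v ↦ by simp,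
    fun i ↦ ?_, fun u v huv ↦ ⟨huv.ne, ?_⟩⟩
  · obtain ⟨v, hv⟩ := Quot.exists_rep (g i)
    refine ⟨v, ?_⟩
    rw [← Function.leftInverse_invFun g.injective i, ← hv]
    exact dif_pos v.2
  · by_cases hu : u ∈ S
    · simp [hu]
    by_cases hv : v ∈ S
    · simp [hv]
    have hadj : (G.induce Sᶜ).Adj ⟨u, hu⟩ ⟨v, hv⟩ := huv
    have hpart : part ⟨u, hu⟩ = part ⟨v, hv⟩ :=
      congrArg (Function.invFun g) (ConnectedComponent.sound hadj.reachable)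
    simp [hu, hv, hpart]

theorem card_le_numComponentsDelete {ι : Type*} {c : V → Option ι} (hsome : ∀ i, ∃ v, c v = some i)
    (hG : G ≤ cliqueJoin c) : Nat.card ι ≤ G.numComponentsDelete {v | c v = none} := by
  set S : Set V := {v | c v = none} with hS
  have hlabel : ∀ {u v}, (G.induce Sᶜ).Reachable u v → c u = c v := by
    rintro u v ⟨p⟩
    induction p with
    | nil => rfl
    | @cons u v _ h _ ih =>
      exact (((hG h).2.resolve_left u.2).resolve_left v.2).trans ih
  choose v hv using hsome
  have hvS : ∀ i, v i ∈ Sᶜ := fun i ↦ by simp [hS, hv]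
  refine Nat.card_le_card_of_injective
    (fun i ↦ (G.induce Sᶜ).connectedComponentMk ⟨v i, hvS i⟩) fun i j hij ↦ ?_
  have := hlabel (ConnectedComponent.exact hij)
  rwa [hv, hv, Option.some_inj] at this

theorem exists_le_cliqueJoin_of_not_isTough_one [Fintype V] (hG : G.Connected)
    (h : ¬ G.IsTough 1) :
    ∃ s, 1 ≤ s ∧ ∃ c : V → Option (Fin (s + 1)), labelCard c none = s ∧
      (∀ i, ∃ v, c v = some i) ∧ G ≤ cliqueJoin c := by
  rw [isTough_one_iff hG] at h
  push Not at h
  obtain ⟨S, hS, hlt⟩ := h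
  obtain ⟨c, hnone, hsome, hGc⟩ := exists_le_cliqueJoin_of_le_numComponentsDelete hlt
  refine ⟨S.ncard, (Set.ncard_pos S.toFinite).2 hS, c, ?_, hsome, hGc⟩
  rw [labelCard_eq_ncard]
  exact congrArg Set.ncard (Set.ext hnone)

theorem not_isTough_one_of_le_cliqueJoin [Fintype V] {ι : Type*} [Fintype ι] [DecidableEq ι]
    {c : V → Option ι} (hconn : G.Connected) (hnone : ∃ v, c v = none)
    (hsome : ∀ i, ∃ v, c v = some i) (hG : G ≤ cliqueJoin c)
    (hcard : labelCard c none < Fintype.card ι) : ¬ G.IsTough 1 := fun h ↦ by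
  have hle := (card_le_numComponentsDelete hsome hG).trans
    ((isTough_one_iff hconn).1 h _ hnone)
  rw [Nat.card_eq_fintype_card, ← labelCard_eq_ncard] at hle
  exact hle.not_gt hcard

end Toughness

theorem not_isTough_one_of_iso_extremalGraph {V : Type*} [Finite V] {G : SimpleGraph V}
    {n d : ℕ} (hconn : G.Connected) (hd : 1 ≤ d) (hn : 2 * d < n) (e : G ≃g extremalGraph n d) :
    ¬ G.IsTough 1 := by
  have := Fintype.ofFinite V
  have hG : G ≤ cliqueJoin (extremalLabel n d 0 ∘ e) := fun u v huv ↦ by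
    exact ⟨huv.ne, ((extremalGraph_eq_cliqueJoin 0).le (e.map_adj_iff.2 huv)).2⟩
  have hlabel : ∀ o, labelCard (extremalLabel n d 0 ∘ e) o = labelCard (extremalLabel n d 0) o :=
    fun o ↦ Finset.card_equiv e.toEquiv (by simp)
  refine not_isTough_one_of_le_cliqueJoin hconn ?_ (fun i ↦ ?_) hG ?_
  · rwa [← labelCard_pos_iff, hlabel, labelCard_extremalLabel_none]
  · rw [← labelCard_pos_iff, hlabel]
    rcases eq_or_ne i 0 with rfl | hi
    · rw [labelCard_extremalLabel_self]
      omega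
    · rw [labelCard_extremalLabel_of_ne hi]
      exact one_pos
  · rw [hlabel, labelCard_extremalLabel_none, Fintype.card_fin]
    exact Nat.lt_succ_self d

end DistanceSpectrum

theorem theorem1_general {V : Type*} [Fintype V] (G : SimpleGraph V) [DecidableRel G.Adj]
    (n δ : ℕ) (hconn : G.Connected) (hcard : Fintype.card V = n) (hmin : δ ≤ G.minDegree)
    (hδ : 1 ≤ δ) (hn : 8 * δ ≤ n)
    (hspec : G.distSpectralRadius ≤ (SimpleGraph.extremalGraph n δ).distSpectralRadius) :
    (¬ Nonempty (G ≃g SimpleGraph.extremalGraph n δ) → G.IsTough 1) ∧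
      (Nonempty (G ≃g SimpleGraph.extremalGraph n δ) → ¬ G.IsTough 1) := by
  constructor
  · intro hiso
    by_contra htough
    obtain ⟨s, hs, c, hnone, hsome, hGc⟩ :=
      DistanceSpectrum.exists_le_cliqueJoin_of_not_isTough_one hconn htough
    exact hiso (DistanceSpectrum.nonempty_iso_extremalGraph_of_le_cliqueJoin hconn hcard hmin hδ
      hn hspec hs hnone hsome hGc)
  · rintro ⟨e⟩
    exact DistanceSpectrum.not_isTough_one_of_iso_extremalGraph hconn hδ (by omega) e

theorem theorem1 {V : Type*} [Fintype V] (G : SimpleGraph V) [DecidableRel G.Adj] (n δ : ℕ)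
    (hconn : G.Connected) (hcard : Fintype.card V = n) (hmin : G.minDegree = δ) (hδ : 2 ≤ δ)
    (hn : max (8 * (δ : ℝ)) ((δ : ℝ) ^ 2 / 2 + 2 * (δ : ℝ) + 2) ≤ (n : ℝ))
    (hspec : G.distSpectralRadius ≤ (SimpleGraph.extremalGraph n δ).distSpectralRadius) :
    (¬ Nonempty (G ≃g SimpleGraph.extremalGraph n δ) → G.IsTough 1) ∧
      (Nonempty (G ≃g SimpleGraph.extremalGraph n δ) → ¬ G.IsTough 1) :=
  theorem1_general G n δ hconn hcard hmin.ge (by omega)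
    (by exact_mod_cast (le_max_left _ _).trans hn) hspec
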